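/- Let $a<0$, $b<0$, and let $\lambda,\mu>0$ satisfy $(\lambda a)^2+(\mu b)^2\le \tfrac12$. Let $\mathfrak H$ be the space of real sequences $(u_{j,k})_{j,k\ge -1}$ with $\sum_{j,k\ge -1}u_{j,k}^2<\infty$, $u_{-1,k}=u_{0,k}$ for all $k\ge 0$, $u_{j,-1}=u_{j,0}$ for all $j\ge 0$, and $u_{-1,-1}=u_{0,0}$; put $\|u\|_{\mathfrak H}^2:=\sum_{j,k\ge 0}u_{j,k}^2$. Write $\Delta_1u_{j,k}:=u_{j+1,k}-2u_{j,k}+u_{j-1,k}$ and $\Delta_2u_{j,k}:=u_{j,k+1}-2u_{j,k}+u_{j,k-1}$. Let $u^0\in\mathfrak H$ and let $(u^n_{j,k})_{j,k\ge -1}$, $n\in\mathbb N$, be given by the stabilized Lax--Wendroff scheme: for all $n\ge 0$ and all $j,k\ge 0$, $$\begin{aligned}u^{n+1}_{j,k}={}&u^n_{j,k}-\tfrac{\lambda a}{2}\,(u^n_{j+1,k}-u^n_{j-1,k})-\tfrac{\mu b}{2}\,(u^n_{j,k+1}-u^n_{j,k-1})+\tfrac{(\lambda a)^2}{2}\,\Delta_1u^n_{j,k}+\tfrac{(\mu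 b)^2}{2}\,\Delta_2u^n_{j,k}\\&+\tfrac{\lambda a\,\mu b}{4}\,(u^n_{j+1,k+1}-u^n_{j+1,k-1}-u^n_{j-1,k+1}+u^n_{j-1,k-1})-\tfrac{(\lambda a)^2+(\mu b)^2}{8}\,\Delta_1\Delta_2u^n_{j,k},\end{aligned}$$ together with, for all $n\ge 0$, the extrapolation conditions $u^n_{-1,k}=u^n_{0,k}$ ($k\ge0$), $u^n_{j,-1}=u^n_{j,0}$ ($j\ge 0$) and the corner condition $u^n_{-1,-1}=u^n_{0,0}$. Then $u^n\in\mathfrak H$ for all $n$, and for every $n\in\mathbb N$, $$\begin{aligned}\|u^{n+1}\|_{\mathfrak H}^2-\|u^n\|_{\mathfrak H}^2&+\frac{\lambda|a|}{8}\sum_{k\ge0}(u^n_{0,k})^2+\frac{\mu|b|}{8}\sum_{j\ge0}(u^n_{j,0})^2+\frac{(\mu b)^2}{32}\big((\lambda a)^2+(\mu b)^2\big)\sum_{k\ge0}(\Delta_2u^n_{0,k})^2\\&+\frac{(\lambda a)^2}{32}\big((\lambda a)^2+(\mu b)^2\big)\sum_{j\ge0}(\Delta_1u^n_{j,0})^2\le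 0 .\end{aligned}$$ In particular, $$\begin{aligned}\sup_{n\in\mathbb N}\|u^n\|_{\mathfrak H}^2&+\frac{\lambda|a|}{8}\sum_{n\ge0}\sum_{k\ge0}(u^n_{0,k})^2+\frac{\mu|b|}{8}\sum_{n\ge0}\sum_{j\ge0}(u^n_{j,0})^2+\frac{(\mu b)^2}{32}\big((\lambda a)^2+(\mu b)^2\big)\sum_{n\ge0}\sum_{k\ge0}(\Delta_2u^n_{0,k})^2\\&+\frac{(\lambda a)^2}{32}\big((\lambda a)^2+(\mu b)^2\big)\sum_{n\ge0}\sum_{j\ge0}(\Delta_1u^n_{j,0})^2\le 2\,\|u^0\|_{\mathfrak H}^2 ,\end{aligned}$$ where the supremum is finite and all the series converge. -/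

import Mathlib

noncomputable section

namespace LaxWendroff

/-- Second order difference in the first direction,
`(Δ₁ U)_{j,k} = U_{j+1,k} - 2 U_{j,k} + U_{j-1,k}`. -/
def lap1 (U : ℤ → ℤ → ℝ) (j k : ℤ) : ℝ := U (j + 1) k - 2 * U j k + U (j - 1) k

/-- Second order difference in the second direction,
`(Δ₂ U)_{j,k} = U_{j,k+1} - 2 U_{j,k} + U_{j,k-1}`. -/
def lap2 (U : ℤ → ℤ → ℝ) (j k : ℤ) : ℝ := U j (k + 1) - 2 * U j k + U j (k - 1)

/-- The right-hand side, at the index `(j, k)`, of the Lax-Wendroff scheme with stabilizer. -/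
def lwStep (lam mu a b : ℝ) (U : ℤ → ℤ → ℝ) (j k : ℤ) : ℝ :=
  U j k
    - (lam * a) / 2 * (U (j + 1) k - U (j - 1) k)
    - (mu * b) / 2 * (U j (k + 1) - U j (k - 1))
    + (lam * a) ^ 2 / 2 * (U (j + 1) k - 2 * U j k + U (j - 1) k)
    + (mu * b) ^ 2 / 2 * (U j (k + 1) - 2 * U j k + U j (k - 1))
    + (lam * a * mu * b) / 4 *
        (U (j + 1) (k + 1) - U (j + 1) (k - 1) - U (j - 1) (k + 1) + U (j - 1) (k - 1))
    - ((lam * a) ^ 2 + (mu * b) ^ 2) / 8 *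
        (U (j + 1) (k + 1) - 2 * U (j + 1) k + U (j + 1) (k - 1)
          - 2 * U j (k + 1) + 4 * U j k - 2 * U j (k - 1)
          + U (j - 1) (k + 1) - 2 * U (j - 1) k + U (j - 1) (k - 1))

/-- The full set of indices `({-1} ∪ ℕ)²`: the interior cells `ℕ × ℕ` and the ghost cells. -/
def fullGrid : Set (ℤ × ℤ) := {p | -1 ≤ p.1 ∧ -1 ≤ p.2}

/-- The space of sequences that are square summable on `({-1} ∪ ℕ)²` and satisfy the two
extrapolation conditions and the corner condition. A sequence on `({-1} ∪ ℕ)²` is represented by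
a function on `ℤ × ℤ`, whose values at the other indices play no role. -/
structure MemH (U : ℤ → ℤ → ℝ) : Prop where
  memlp : Memℓp (fun p : fullGrid => U p.1.1 p.1.2) 2
  left : ∀ k : ℕ, U (-1) k = U 0 k
  bottom : ∀ j : ℕ, U j (-1) = U j 0
  corner : U (-1) (-1) = U 0 0

/-- The squared norm, which only uses the interior values. -/
def normSqH (U : ℤ → ℤ → ℝ) : ℝ := ∑' p : ℕ × ℕ, (U p.1 p.2) ^ 2

/-- `u n j k` (for `j, k ≥ -1`) is the numerical solution on the quarter-space: the scheme at the
interior indices, extrapolation on both sides and at the corner at every time step, and a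
square summable initial condition. -/
structure IsNumericalSolution (lam mu a b : ℝ) (u : ℕ → ℤ → ℤ → ℝ) : Prop where
  init : MemH (u 0)
  scheme : ∀ n j k : ℕ, u (n + 1) j k = lwStep lam mu a b (u n) j k
  left : ∀ n k : ℕ, u n (-1) k = u n 0 k
  bottom : ∀ n j : ℕ, u n j (-1) = u n j 0
  corner : ∀ n : ℕ, u n (-1) (-1) = u n 0 0

end LaxWendroff

end

namespace LaxWendroff

/-! With α = λa and β = μb, the local energy change (u^{n+1})² - (u^n)² is a discrete divergence
minus two quadratic forms (`lwStep_energy_identity`). One carries the factor 1 - 2(α² + β²),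
nonnegative by the CFL condition; the other, `dissipation`, is nonnegative for every α and β.
Summation over the quarter-space leaves only the fluxes on j = 0 and k = 0, which the extrapolation
turns into quadratic forms of the one-dimensional traces.

On a half-line, write ω = sin²(θ/2). The squares of v, of its first difference and of its second
difference have symbols 1, 4ω, 16ω², so the boundary forms have symbol A + Bω + Cω² with A, B ≥ 0.
By `half_line_form_lower_bound`, nonnegativity at ω = 1 is enough, and half of A survives at the
corner; this pays for the unfavourable corner term αβ u₀₀².

By transposition one may take α² ≤ β². The bottom form then satisfies the condition directly. The
left one may fail it when |α| is small, and needs part of the interior dissipation: the latter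
controls κ(S_{j+1}² + S_j²)/8, where S_j = Δ₂u_j + Δ₂u_{j-1}, and adding κS_j²/32 to the flux
converts this into a trace term on j = 0. -/

/-! ### Local energy balance and interior dissipation -/

/-- The numerical flux of the energy in the first direction, through the face `j - 1/2`. -/
noncomputable def flux1 (α β κ : ℝ) (U : ℤ → ℤ → ℝ) (j k : ℤ) : ℝ :=
  -α * (U j k * U (j - 1) k)
    + α ^ 2 / 2 * ((U j k - U (j - 1) k) * (U j k + U (j - 1) k))
    + α * β / 2 * (U (j - 1) k * (U j (k + 1) - U j (k - 1)))
    + α * β / 2 * (U j k * (U (j - 1) (k + 1) - U (j - 1) (k - 1)))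
    - (α ^ 2 + β ^ 2) / 8 * ((U j k + U (j - 1) k) * (lap2 U j k - lap2 U (j - 1) k))
    - α ^ 3 / 2 * ((U j k - U (j - 1) k) * (U j k - U (j - 1) k))
    + α * β ^ 2 / 4 * ((U j (k + 1) - U j k) * (U (j - 1) (k + 1) - U (j - 1) k))
    + α * β ^ 2 / 4 * ((U j k - U j (k - 1)) * (U (j - 1) k - U (j - 1) (k - 1)))
    - (α * (α ^ 2 + β ^ 2) / 16 + α * β * (α ^ 2 + β ^ 2) / 4)
      * ((U j (k + 1) - U j k - (U (j - 1) (k + 1) - U (j - 1) k))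
        * (U j (k + 1) - U j k - (U (j - 1) (k + 1) - U (j - 1) k)))
    - (α * (α ^ 2 + β ^ 2) / 16 - α * β * (α ^ 2 + β ^ 2) / 4)
      * ((U j k - U j (k - 1) - (U (j - 1) k - U (j - 1) (k - 1)))
        * (U j k - U j (k - 1) - (U (j - 1) k - U (j - 1) (k - 1))))
    - α ^ 2 * β / 4 * ((U j (k + 1) - U j (k - 1) + (U (j - 1) (k + 1) - U (j - 1) (k - 1)))
        * (U j k - U (j - 1) k))
    - α * β ^ 2 / 4 * ((U j (k + 1) - U j (k - 1)) * (U (j - 1) (k + 1) - U (j - 1) (k - 1)))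
    + β * (α ^ 2 + β ^ 2) / 16
      * ((U j (k + 1) - U j (k - 1) + (U (j - 1) (k + 1) - U (j - 1) (k - 1)))
        * (lap2 U j k - lap2 U (j - 1) k))
    + κ / 32 * ((lap2 U j k + lap2 U (j - 1) k) * (lap2 U j k + lap2 U (j - 1) k))

/-- The numerical flux of the energy in the second direction, through the face `k - 1/2`. -/
noncomputable def flux2 (α β : ℝ) (U : ℤ → ℤ → ℝ) (j k : ℤ) : ℝ :=
  -β * (U j k * U j (k - 1))
    + β ^ 2 / 2 * ((U j k - U j (k - 1)) * (U j k + U j (k - 1)))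
    + (α ^ 2 + β ^ 2) / 16 * ((U (j + 1) k - U j k - (U (j + 1) (k - 1) - U j (k - 1)))
        * (U (j + 1) k - U j k + (U (j + 1) (k - 1) - U j (k - 1))))
    + (α ^ 2 + β ^ 2) / 16 * ((U j k - U (j - 1) k - (U j (k - 1) - U (j - 1) (k - 1)))
        * (U j k - U (j - 1) k + (U j (k - 1) - U (j - 1) (k - 1))))
    - β ^ 3 / 2 * ((U j k - U j (k - 1)) * (U j k - U j (k - 1)))
    + α ^ 2 * β / 4 * ((U (j + 1) k - U j k) * (U (j + 1) (k - 1) - U j (k - 1)))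
    + α ^ 2 * β / 4 * ((U j k - U (j - 1) k) * (U j (k - 1) - U (j - 1) (k - 1)))
    - β * (α ^ 2 + β ^ 2) / 16
      * ((U (j + 1) k - U j k - (U (j + 1) (k - 1) - U j (k - 1)))
        * (U (j + 1) k - U j k - (U (j + 1) (k - 1) - U j (k - 1))))
    - β * (α ^ 2 + β ^ 2) / 16
      * ((U j k - U (j - 1) k - (U j (k - 1) - U (j - 1) (k - 1)))
        * (U j k - U (j - 1) k - (U j (k - 1) - U (j - 1) (k - 1))))
    - α * β ^ 2 / 4 * ((U (j + 1) k - U (j - 1) k + (U (j + 1) (k - 1) - U (j - 1) (k - 1)))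
        * (U j k - U j (k - 1)))
    - α ^ 2 * β / 4 * ((U (j + 1) k - U (j - 1) k) * (U (j + 1) (k - 1) - U (j - 1) (k - 1)))
    + α * (α ^ 2 + β ^ 2) / 16
      * ((U (j + 1) k - U (j - 1) k + (U (j + 1) (k - 1) - U (j - 1) (k - 1)))
        * (lap1 U j k - lap1 U j (k - 1)))

/-- The form which is nonnegative and controls the traces when `α ^ 2 ≠ β ^ 2`. -/
noncomputable def dissipation (α β x y r s t : ℝ) : ℝ :=
  (α ^ 2 + β ^ 2) * ((α * x - β * r) ^ 2 + (β * y - α * r) ^ 2)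
    + (α * β * (y - x) + (α ^ 2 - β ^ 2) * r) ^ 2
    + 2 * (α ^ 2 + β ^ 2) ^ 2 * (s ^ 2 + t ^ 2) - 8 * (α ^ 2 + β ^ 2) * (α * β) * (s * t)

/-- Completing the square in `s` leaves the factor (α² + β²)² - 4α²β² = (α² - β²)² in front of `t ^
2`. -/
lemma dissipation_st_lower_bound (α β s t : ℝ) :
    (α ^ 2 - β ^ 2) ^ 2 * β ^ 2 * t ^ 2 ≤ (α ^ 2 + β ^ 2) *
      (2 * (α ^ 2 + β ^ 2) ^ 2 * (s ^ 2 + t ^ 2)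
        - 8 * (α ^ 2 + β ^ 2) * (α * β) * (s * t)) := by
  have h : 0 ≤ 2 * (α ^ 2 + β ^ 2) * ((α ^ 2 + β ^ 2) * s - 2 * (α * β) * t) ^ 2
      + (α ^ 2 - β ^ 2) ^ 2 * (2 * α ^ 2 + β ^ 2) * t ^ 2 := by positivity
  linarith only [h, show (α ^ 2 + β ^ 2) *
      (2 * (α ^ 2 + β ^ 2) ^ 2 * (s ^ 2 + t ^ 2)
        - 8 * (α ^ 2 + β ^ 2) * (α * β) * (s * t)) - (α ^ 2 - β ^ 2) ^ 2 * β ^ 2 * t ^ 2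
      = 2 * (α ^ 2 + β ^ 2) * ((α ^ 2 + β ^ 2) * s - 2 * (α * β) * t) ^ 2
      + (α ^ 2 - β ^ 2) ^ 2 * (2 * α ^ 2 + β ^ 2) * t ^ 2 by ring]

/-- A binary quadratic form with positive last coefficient and nonnegative determinant. -/
lemma binary_form_nonneg {a b c : ℝ} (hc : 0 < c) (hd : 0 ≤ a * c - b ^ 2) (x y : ℝ) :
    0 ≤ a * x ^ 2 + 2 * b * (x * y) + c * y ^ 2 := by
  have h : c * (a * x ^ 2 + 2 * b * (x * y) + c * y ^ 2)
      = (a * c - b ^ 2) * x ^ 2 + (b * x + c * y) ^ 2 := by ring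
  have h' : 0 ≤ c * (a * x ^ 2 + 2 * b * (x * y) + c * y ^ 2) := by
    rw [h]; positivity
  exact nonneg_of_mul_nonneg_right h' hc

/-- In the variables `X`, `Y`, `R` the difference of the two sides is a ternary form whose `X ^ 2`
coefficient is (α² + β²)(α² + 2β²). Multiplying by α² + 2β² completes the square in `X`; a
determinant settles the remaining form in `Y`, `R`. -/
lemma dissipation_xyr_lower_bound (α β x y r : ℝ) (hβ : β ≠ 0) :
    (α ^ 2 - β ^ 2) ^ 2 * β ^ 2 * y ^ 2 ≤ (α ^ 2 + β ^ 2) *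
      ((α ^ 2 + β ^ 2) * ((α * x - β * r) ^ 2 + (β * y - α * r) ^ 2)
        + (α * β * (y - x) + (α ^ 2 - β ^ 2) * r) ^ 2) := by
  have hβ2 : 0 < β ^ 2 := by positivity
  set X := α * x - β * r with hX
  set Y := β * y - α * r with hY
  set R := (α ^ 2 - β ^ 2) * r with hR
  have hthird : α * β * (y - x) + R = α * Y - β * X + 2 * R := by
    rw [hX, hY, hR]; ring
  have hy : (α ^ 2 - β ^ 2) ^ 2 * β ^ 2 * y ^ 2 = ((α ^ 2 - β ^ 2) * Y + α * R) ^ 2 := by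
    rw [hY, hR]; ring
  rw [hthird, hy]
  clear_value X Y R
  have hq := binary_form_nonneg
    (a := 2 * (α ^ 2 + β ^ 2) ^ 3 - (α ^ 2 + 2 * β ^ 2) * (α ^ 2 - β ^ 2) ^ 2)
    (b := (2 * (α ^ 2 + β ^ 2) ^ 2 - (α ^ 2 + 2 * β ^ 2) * (α ^ 2 - β ^ 2)) * α)
    (c := 4 * (α ^ 2 + β ^ 2) ^ 2 - (α ^ 2 + 2 * β ^ 2) * α ^ 2)
    (by
      have : 4 * (α ^ 2 + β ^ 2) ^ 2 - (α ^ 2 + 2 * β ^ 2) * α ^ 2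
        = 3 * α ^ 4 + 6 * α ^ 2 * β ^ 2 + 4 * (β ^ 2) ^ 2 := by ring
      rw [this]; positivity)
    (by
      have : (2 * (α ^ 2 + β ^ 2) ^ 3 - (α ^ 2 + 2 * β ^ 2) * (α ^ 2 - β ^ 2) ^ 2)
          * (4 * (α ^ 2 + β ^ 2) ^ 2 - (α ^ 2 + 2 * β ^ 2) * α ^ 2)
          - ((2 * (α ^ 2 + β ^ 2) ^ 2 - (α ^ 2 + 2 * β ^ 2) * (α ^ 2 - β ^ 2)) * α) ^ 2
          = (α ^ 2 + β ^ 2) ^ 2 * (2 * α ^ 2 + 10 * β ^ 2) * (α ^ 2 * (α ^ 2 + 2 * β ^ 2)) := by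
        ring
      rw [this]; positivity) Y R
  have hmul : (α ^ 2 + 2 * β ^ 2) * ((α ^ 2 + β ^ 2) * ((α ^ 2 + β ^ 2) * (X ^ 2 + Y ^ 2)
        + (α * Y - β * X + 2 * R) ^ 2) - ((α ^ 2 - β ^ 2) * Y + α * R) ^ 2)
      = (α ^ 2 + β ^ 2) * ((α ^ 2 + 2 * β ^ 2) * X - β * (α * Y + 2 * R)) ^ 2
        + ((2 * (α ^ 2 + β ^ 2) ^ 3 - (α ^ 2 + 2 * β ^ 2) * (α ^ 2 - β ^ 2) ^ 2) * Y ^ 2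
          + 2 * ((2 * (α ^ 2 + β ^ 2) ^ 2 - (α ^ 2 + 2 * β ^ 2) * (α ^ 2 - β ^ 2)) * α) * (Y * R)
          + (4 * (α ^ 2 + β ^ 2) ^ 2 - (α ^ 2 + 2 * β ^ 2) * α ^ 2) * R ^ 2) := by
    ring
  have hnn : 0 ≤ (α ^ 2 + 2 * β ^ 2) * ((α ^ 2 + β ^ 2) * ((α ^ 2 + β ^ 2) * (X ^ 2 + Y ^ 2)
        + (α * Y - β * X + 2 * R) ^ 2) - ((α ^ 2 - β ^ 2) * Y + α * R) ^ 2) := by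
    rw [hmul]; exact add_nonneg (by positivity) hq
  exact sub_nonneg.1 (nonneg_of_mul_nonneg_right hnn (by positivity))

lemma dissipation_lower_bound (α β x y r s t : ℝ) (hβ : β ≠ 0) :
    β ^ 2 * (α ^ 2 - β ^ 2) ^ 2 / (α ^ 2 + β ^ 2) * (y ^ 2 + t ^ 2)
      ≤ dissipation α β x y r s t := by
  have hc : 0 < α ^ 2 + β ^ 2 := by positivity
  rw [div_mul_eq_mul_div, div_le_iff₀ hc, dissipation]
  linarith only [dissipation_xyr_lower_bound α β x y r hβ, dissipation_st_lower_bound α β s t]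

/-- The local energy identity. -/
lemma lwStep_energy_identity (α β κ : ℝ) (U : ℤ → ℤ → ℝ) (j k : ℤ) (P Q r m s t : ℝ)
    (hP : P = lap1 U j k) (hQ : Q = lap2 U j k)
    (hr : r = (U (j + 1) (k + 1) - U (j + 1) (k - 1) - U (j - 1) (k + 1)
      + U (j - 1) (k - 1)) / 4)
    (hm : m = (lap2 U (j + 1) k - 2 * lap2 U j k + lap2 U (j - 1) k) / 4)
    (hs : s = (lap1 U j (k + 1) - lap1 U j (k - 1)) / 4)
    (ht : t = (lap2 U (j + 1) k - lap2 U (j - 1) k) / 4) :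
    lwStep 1 1 α β U j k ^ 2 - U j k ^ 2
      = (flux1 α β κ U (j + 1) k - flux1 α β κ U j k)
        + (flux2 α β U j (k + 1) - flux2 α β U j k)
        - (1 - 2 * (α ^ 2 + β ^ 2)) / 4 * (α ^ 2 * P ^ 2 + β ^ 2 * Q ^ 2
          + (α ^ 2 + β ^ 2) * (r ^ 2 + m ^ 2 + s ^ 2 + t ^ 2))
        - 1 / 4 * dissipation α β (P + m) (Q + m) r s t
        - κ / 32 * ((lap2 U (j + 1) k + lap2 U j k) ^ 2
          - (lap2 U j k + lap2 U (j - 1) k) ^ 2) := by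
  subst hP hQ hr hm hs ht
  simp only [lwStep, flux1, flux2, lap1, lap2, dissipation, one_mul, add_sub_cancel_right,
    mul_one]
  generalize U (j + 1) (k + 1) = upp
  generalize U (j + 1) k = upz
  generalize U (j + 1) (k - 1) = upm
  generalize U j (k + 1) = uzp
  generalize U j k = uzz
  generalize U j (k - 1) = uzm
  generalize U (j - 1) (k + 1) = ump
  generalize U (j - 1) k = umz
  generalize U (j - 1) (k - 1) = umm
  ring

/-- With y = Q + m and S± = lap2 U j k + lap2 U (j ± 1) k, one has y² + t² = (S₊² + S₋²)/8. A
quarter of the dissipation therefore absorbs the κ-term (κ/32)(S₊² - S₋²) of either sign. -/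
lemma lwStep_energy_le {α β : ℝ} (hβ : β ≠ 0) (hc : α ^ 2 + β ^ 2 ≤ 1 / 2)
    (U : ℤ → ℤ → ℝ) (j k : ℤ) {κ : ℝ}
    (hκ : κ = β ^ 2 * (α ^ 2 - β ^ 2) ^ 2 / (α ^ 2 + β ^ 2)) :
    lwStep 1 1 α β U j k ^ 2 - U j k ^ 2
      ≤ (flux1 α β κ U (j + 1) k - flux1 α β κ U j k)
        + (flux2 α β U j (k + 1) - flux2 α β U j k) := by
  have hκ0 : 0 ≤ κ := by rw [hκ]; positivity
  rw [lwStep_energy_identity α β κ U j k _ _ _ _ _ _ rfl rfl rfl rfl rfl rfl]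
  have h1 := dissipation_lower_bound α β
    (lap1 U j k + (lap2 U (j + 1) k - 2 * lap2 U j k + lap2 U (j - 1) k) / 4)
    (lap2 U j k + (lap2 U (j + 1) k - 2 * lap2 U j k + lap2 U (j - 1) k) / 4)
    ((U (j + 1) (k + 1) - U (j + 1) (k - 1) - U (j - 1) (k + 1) + U (j - 1) (k - 1)) / 4)
    ((lap1 U j (k + 1) - lap1 U j (k - 1)) / 4)
    ((lap2 U (j + 1) k - lap2 U (j - 1) k) / 4) hβ
  rw [← hκ] at h1
  have h2 : 0 ≤ (1 - 2 * (α ^ 2 + β ^ 2)) / 4 * (α ^ 2 * lap1 U j k ^ 2 + β ^ 2 * lap2 U j k ^ 2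
      + (α ^ 2 + β ^ 2) * (
        ((U (j + 1) (k + 1) - U (j + 1) (k - 1) - U (j - 1) (k + 1) + U (j - 1) (k - 1)) / 4) ^ 2
        + ((lap2 U (j + 1) k - 2 * lap2 U j k + lap2 U (j - 1) k) / 4) ^ 2
        + ((lap1 U j (k + 1) - lap1 U j (k - 1)) / 4) ^ 2
        + ((lap2 U (j + 1) k - lap2 U (j - 1) k) / 4) ^ 2)) :=
    mul_nonneg (by linarith) (by positivity)
  have h3 : 0 ≤ κ / 16 * (lap2 U (j + 1) k + lap2 U j k) ^ 2 := by positivity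
  linarith only [h1, h2, h3]

/-! ### Square summability and telescoping on the quarter-space -/

/-- Real families whose squares are summable. -/
def SqSummable {ι : Type*} (f : ι → ℝ) : Prop := Summable fun i => f i ^ 2

namespace SqSummable

variable {ι : Type*} {f g : ι → ℝ}

lemma mul (hf : SqSummable f) (hg : SqSummable g) : Summable fun i => f i * g i := by
  refine Summable.of_norm_bounded (Summable.add hf hg) fun i => ?_
  rw [Real.norm_eq_abs, abs_le]
  constructor <;> nlinarith only [sq_nonneg (f i + g i), sq_nonneg (f i - g i), sq_nonneg (f i),
    sq_nonneg (g i)]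

lemma const_mul (c : ℝ) (hf : SqSummable f) : SqSummable fun i => c * f i := by
  simpa only [SqSummable, mul_pow] using Summable.mul_left (c ^ 2) hf

lemma add (hf : SqSummable f) (hg : SqSummable g) : SqSummable fun i => f i + g i := by
  have h := (Summable.add hf hg).add ((hf.mul hg).mul_left 2)
  exact h.congr fun i => by ring

lemma sub (hf : SqSummable f) (hg : SqSummable g) : SqSummable fun i => f i - g i := by
  have h := (Summable.add hf hg).sub ((hf.mul hg).mul_left 2)
  exact h.congr fun i => by ring

end SqSummable

lemma lwStep_eq_lwStep_one (lam mu a b : ℝ) (U : ℤ → ℤ → ℝ) (j k : ℤ) :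
    lwStep lam mu a b U j k = lwStep 1 1 (lam * a) (mu * b) U j k := by
  simp only [lwStep]; ring

lemma lwStep_transpose (α β : ℝ) (U : ℤ → ℤ → ℝ) (j k : ℤ) :
    lwStep 1 1 β α (fun k j => U j k) k j = lwStep 1 1 α β U j k := by
  simp only [lwStep]; ring

lemma MemH.sqSummable {U : ℤ → ℤ → ℝ} (hU : MemH U) {s t : ℤ} (hs : -1 ≤ s) (ht : -1 ≤ t) :
    SqSummable fun p : ℕ × ℕ => U (p.1 + s) (p.2 + t) := by
  have h := (memℓp_gen_iff (by norm_num)).1 hU.memlp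
  have hi : Function.Injective (fun p : ℕ × ℕ =>
      (⟨((p.1 : ℤ) + s, (p.2 : ℤ) + t), by
        constructor <;> dsimp only <;> lia⟩ : fullGrid)) := by
    rintro ⟨a, b⟩ ⟨c, d⟩ hab
    simp only [Subtype.ext_iff, Prod.ext_iff] at hab
    ext <;> dsimp only <;> lia
  have h2 := h.comp_injective hi
  refine h2.congr fun p => ?_
  simp

/-- Square summability on the interior and the extrapolation conditions give membership. -/
lemma memH_of_sqSummable {U : ℤ → ℤ → ℝ} (h : SqSummable fun p : ℕ × ℕ => U p.1 p.2)
    (left : ∀ k : ℕ, U (-1) k = U 0 k) (bottom : ∀ j : ℕ, U j (-1) = U j 0)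
    (corner : U (-1) (-1) = U 0 0) : MemH U := by
  refine ⟨?_, left, bottom, corner⟩
  have hrow : ∀ j : ℕ, Summable fun k : ℕ => U j k ^ 2 := h.prod_factor
  have hcol : Summable fun j : ℕ => U j 0 ^ 2 := by
    have := h.prod_symm.prod_factor 0
    simpa using this
  have hshift : Summable fun p : ℕ × ℕ => U ((p.1 : ℤ) - 1) ((p.2 : ℤ) - 1) ^ 2 := by
    have hrow' : ∀ j : ℕ, Summable fun k : ℕ => U j ((k : ℤ) - 1) ^ 2 := fun j => by
      rw [← summable_nat_add_iff 1]
      simpa using hrow j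
    have hghost : ∀ k : ℕ, U (-1) ((k : ℤ) - 1) = U 0 ((k : ℤ) - 1) := by
      rintro (_ | k)
      · have := bottom 0
        simp only [Nat.cast_zero] at this
        simp [corner, this]
      · simpa using left k
    rw [summable_prod_of_nonneg fun _ => sq_nonneg _]
    constructor
    · rintro (_ | j)
      · simpa [hghost] using hrow' 0
      · simpa using hrow' j
    -- The ghost row j = -1 is dropped; in every other row the ghost cell adds one copy of `U j 0 ^
    -- 2`, which `hcol` sums.
    · rw [← summable_nat_add_iff 1]
      have hsum := ((summable_prod_of_nonneg fun _ => sq_nonneg _).1 h).2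
      refine (hcol.add hsum).congr fun j => ?_
      simp only [Nat.cast_add, Nat.cast_one, add_sub_cancel_right]
      rw [(hrow' j).tsum_eq_zero_add]
      simp [bottom]
  refine (memℓp_gen_iff (by norm_num)).2 ?_
  have hi : Function.Injective (fun p : fullGrid => ((p.1.1 + 1).toNat, (p.1.2 + 1).toNat)) := by
    rintro ⟨⟨a, b⟩, ha, hb⟩ ⟨⟨c, d⟩, hc, hd⟩ hab
    simp only [Prod.mk.injEq] at hab ha hb hc hd
    ext <;> dsimp only <;> lia
  refine (hshift.comp_injective hi).congr ?_
  rintro ⟨⟨a, b⟩, ha, hb⟩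
  dsimp only at ha hb
  have h1 : (((a + 1).toNat : ℕ) : ℤ) - 1 = a := by lia
  have h2 : (((b + 1).toNat : ℕ) : ℤ) - 1 = b := by lia
  simp only [Function.comp_apply, h1, h2]
  simp

/-- Telescoping in the first direction on the quarter-space. -/
lemma hasSum_telescope_fst {F : ℤ → ℤ → ℝ} (hF : Summable fun p : ℕ × ℕ => F p.1 p.2) :
    HasSum (fun p : ℕ × ℕ => F (p.1 + 1) p.2 - F p.1 p.2) (-∑' k : ℕ, F 0 k) := by
  have hi : Function.Injective (fun p : ℕ × ℕ => (p.1 + 1, p.2)) := by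
    rintro ⟨a, b⟩ ⟨c, d⟩ h
    simpa using h
  have hF' : Summable fun p : ℕ × ℕ => F ((p.1 : ℤ) + 1) p.2 := by
    simpa [Function.comp_def] using hF.comp_injective hi
  have h1 := hF.tsum_prod
  have h2 := hF'.tsum_prod
  rw [hF.prod.tsum_eq_zero_add] at h1
  have h3 : -∑' k : ℕ, F 0 k
      = ∑' p : ℕ × ℕ, F ((p.1 : ℤ) + 1) p.2 - ∑' p : ℕ × ℕ, F p.1 p.2 := by
    rw [h1, h2]
    simp
  rw [h3]
  exact hF'.hasSum.sub hF.hasSum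

/-- Telescoping in the second direction on the quarter-space. -/
lemma hasSum_telescope_snd {G : ℤ → ℤ → ℝ} (hG : Summable fun p : ℕ × ℕ => G p.1 p.2) :
    HasSum (fun p : ℕ × ℕ => G p.1 (p.2 + 1) - G p.1 p.2) (-∑' j : ℕ, G j 0) :=
  (Equiv.prodComm ℕ ℕ).hasSum_iff.1
    (hasSum_telescope_fst (F := fun k j => G j k) ((Equiv.prodComm ℕ ℕ).summable_iff.2 hG))

/-! ### Quadratic forms of traces on a half-line -/

section OneDimensional

variable {v : ℤ → ℝ}

lemma sqSummable_shift (hv : SqSummable fun k : ℕ => v k) :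
    (SqSummable fun k : ℕ => v (k + 1)) ∧ SqSummable fun k : ℕ => v (k - 1) := by
  constructor
  · have := (summable_nat_add_iff 1).2 hv
    simpa [SqSummable] using this
  · rw [SqSummable, ← summable_nat_add_iff 1]
    simpa [SqSummable] using hv

lemma sqSummable_diff (hv : SqSummable fun k : ℕ => v k) :
    SqSummable fun k : ℕ => v (k + 1) - v k :=
  (sqSummable_shift hv).1.sub hv

lemma sqSummable_second_diff (hv : SqSummable fun k : ℕ => v k) :
    SqSummable fun k : ℕ => v (k + 1) - 2 * v k + v (k - 1) :=
  ((sqSummable_shift hv).1.sub (hv.const_mul 2)).add (sqSummable_shift hv).2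

lemma hasSum_diff_prev (hv : SqSummable fun k : ℕ => v k) (h0 : v (-1) = v 0) :
    HasSum (fun k : ℕ => (v k - v (k - 1)) ^ 2) (∑' k : ℕ, (v (k + 1) - v k) ^ 2) := by
  rw [← hasSum_nat_add_iff' 1]
  simpa [h0] using (sqSummable_diff hv).hasSum

lemma hasSum_sq_next (hv : SqSummable fun k : ℕ => v k) :
    HasSum (fun k : ℕ => v (k + 1) ^ 2) (∑' k : ℕ, v k ^ 2 - v 0 ^ 2) := by
  have := (hasSum_nat_add_iff' 1).2 hv.hasSum
  simpa using this

lemma tsum_sq_second_diff_le (hv : SqSummable fun k : ℕ => v k) (h0 : v (-1) = v 0) :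
    ∑' k : ℕ, (v (k + 1) - 2 * v k + v (k - 1)) ^ 2
      ≤ 4 * ∑' k : ℕ, (v (k + 1) - v k) ^ 2 := by
  have h := ((sqSummable_diff hv).hasSum.mul_left 2).add ((hasSum_diff_prev hv h0).mul_left 2)
  have := hasSum_le (fun k : ℕ => by
    nlinarith only [sq_nonneg (v (k + 1) - v (k - 1))]) (sqSummable_second_diff hv).hasSum h
  linarith only [this]

lemma tsum_sq_diff_le (hv : SqSummable fun k : ℕ => v k) :
    ∑' k : ℕ, (v (k + 1) - v k) ^ 2 ≤ 4 * (∑' k : ℕ, v k ^ 2) - 2 * v 0 ^ 2 := by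
  have h := (hv.hasSum.mul_left 2).add ((hasSum_sq_next hv).mul_left 2)
  have := hasSum_le (fun k : ℕ => by
    nlinarith only [sq_nonneg (v (k + 1) + v k)]) (sqSummable_diff hv).hasSum h
  linarith only [this]

lemma hasSum_mul_next_sub_mul_prev (hv : SqSummable fun k : ℕ => v k) (h0 : v (-1) = v 0) :
    HasSum (fun k : ℕ => v k * v (k + 1) - v k * v (k - 1)) (-v 0 ^ 2) := by
  have h := (hv.mul (sqSummable_shift hv).1).hasSum
  have h' : HasSum (fun k : ℕ => v k * v (k - 1))
      (∑' k : ℕ, v k * v (k + 1) + v 0 ^ 2) := by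
    rw [← hasSum_nat_add_iff' 1]
    simpa [h0, sq, mul_comm] using h
  have e : -v 0 ^ 2 = ∑' k : ℕ, v k * v (k + 1) - (∑' k : ℕ, v k * v (k + 1) + v 0 ^ 2) := by
    ring
  rw [e]
  exact h.sub h'

/-- A quadratic form on a half-line with Neumann condition controls the value at the corner. -/
lemma half_line_form_lower_bound (hv : SqSummable fun k : ℕ => v k) (h0 : v (-1) = v 0)
    {A B C : ℝ} (hA : 0 ≤ A) (hB : 0 ≤ B) (hABC : 0 ≤ A + B + C) :
    A / 2 * v 0 ^ 2 ≤ A * ∑' k : ℕ, v k ^ 2 + B / 4 * ∑' k : ℕ, (v (k + 1) - v k) ^ 2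
      + C / 16 * ∑' k : ℕ, (v (k + 1) - 2 * v k + v (k - 1)) ^ 2 := by
  have h1 := tsum_sq_second_diff_le hv h0
  have h2 := tsum_sq_diff_le hv
  have h3 : v 0 ^ 2 ≤ ∑' k : ℕ, v k ^ 2 := by
    simpa using hv.le_tsum 0 fun _ _ => sq_nonneg _
  have h4 : 0 ≤ ∑' k : ℕ, (v (k + 1) - v k) ^ 2 := tsum_nonneg fun _ => sq_nonneg _
  have h5 : 0 ≤ ∑' k : ℕ, (v (k + 1) - 2 * v k + v (k - 1)) ^ 2 :=
    tsum_nonneg fun _ => sq_nonneg _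
  have h6 : 0 ≤ v 0 ^ 2 := sq_nonneg _
  generalize (∑' k : ℕ, v k ^ 2) = S at *
  generalize (∑' k : ℕ, (v (k + 1) - v k) ^ 2) = d at *
  generalize (∑' k : ℕ, (v (k + 1) - 2 * v k + v (k - 1)) ^ 2) = D at *
  generalize v 0 ^ 2 = w at *
  have hAS : A * w ≤ A * S := mul_le_mul_of_nonneg_left h3 hA
  have hAw : 0 ≤ A * w := mul_nonneg hA h6
  -- Negative coefficients are moved down the chain D ≤ 4d, d ≤ 4S - 2w. In the last case this
  -- leaves (A + B + C)S - (B + C)w/2, and S ≥ w then gives Aw/2 + (A + B + C)w/2.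
  rcases le_total 0 C with hC | hC
  · linarith only [hAS, hAw, mul_nonneg hB h4, mul_nonneg hC h5]
  have hCD : C * (4 * d) ≤ C * D := mul_le_mul_of_nonpos_left h1 hC
  rcases le_total 0 (B + C) with hBC | hBC
  · linarith only [hAS, hAw, mul_nonneg hBC h4, hCD]
  · have hd := mul_le_mul_of_nonpos_left h2 hBC
    have hS := mul_le_mul_of_nonneg_left h3 hABC
    have hw := mul_nonneg hABC h6
    linarith only [hCD, hd, hS, hw]

end OneDimensional

/-! ### Summability of the fluxes and their boundary values -/

/-- `Summable.sub` for real families; this form unifies at reducible transparency. -/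
lemma summable_sub_real {ι : Type*} {f g : ι → ℝ} (hf : Summable f) (hg : Summable g) :
    Summable fun i => f i - g i :=
  hf.sub hg

lemma MemH.summable_flux1 {U : ℤ → ℤ → ℝ} (hU : MemH U) (α β κ : ℝ) :
    Summable fun p : ℕ × ℕ => flux1 α β κ U p.1 p.2 := by
  have h1 := hU.sqSummable (s := 0) (t := 1) (by norm_num) (by norm_num)
  have h2 := hU.sqSummable (s := 0) (t := 0) (by norm_num) (by norm_num)
  have h3 := hU.sqSummable (s := 0) (t := -1) (by norm_num) (by norm_num)
  have h4 := hU.sqSummable (s := -1) (t := 1) (by norm_num) (by norm_num)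
  have h5 := hU.sqSummable (s := -1) (t := 0) (by norm_num) (by norm_num)
  have h6 := hU.sqSummable (s := -1) (t := -1) (by norm_num) (by norm_num)
  simp only [add_zero, ← sub_eq_add_neg] at h1 h2 h3 h4 h5 h6
  simp only [flux1, lap2]
  -- This pass stops at products of two factors; the next one reduces each factor to shifts of `U`.
  repeat' first
    | with_reducible refine Summable.add ?_ ?_
    | with_reducible refine summable_sub_real ?_ ?_
    | with_reducible refine Summable.mul_left _ ?_
    | with_reducible refine SqSummable.mul ?_ ?_
  all_goals repeat' first
    | with_reducible refine SqSummable.add ?_ ?_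
    | with_reducible refine SqSummable.sub ?_ ?_
    | with_reducible refine SqSummable.const_mul _ ?_
    | with_reducible assumption

lemma MemH.summable_flux2 {U : ℤ → ℤ → ℝ} (hU : MemH U) (α β : ℝ) :
    Summable fun p : ℕ × ℕ => flux2 α β U p.1 p.2 := by
  have h1 := hU.sqSummable (s := 1) (t := 0) (by norm_num) (by norm_num)
  have h2 := hU.sqSummable (s := 0) (t := 0) (by norm_num) (by norm_num)
  have h3 := hU.sqSummable (s := -1) (t := 0) (by norm_num) (by norm_num)
  have h4 := hU.sqSummable (s := 1) (t := -1) (by norm_num) (by norm_num)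
  have h5 := hU.sqSummable (s := 0) (t := -1) (by norm_num) (by norm_num)
  have h6 := hU.sqSummable (s := -1) (t := -1) (by norm_num) (by norm_num)
  simp only [add_zero, ← sub_eq_add_neg] at h1 h2 h3 h4 h5 h6
  simp only [flux2, lap1]
  repeat' first
    | with_reducible refine Summable.add ?_ ?_
    | with_reducible refine summable_sub_real ?_ ?_
    | with_reducible refine Summable.mul_left _ ?_
    | with_reducible refine SqSummable.mul ?_ ?_
  all_goals repeat' first
    | with_reducible refine SqSummable.add ?_ ?_
    | with_reducible refine SqSummable.sub ?_ ?_
    | with_reducible refine SqSummable.const_mul _ ?_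
    | with_reducible assumption

lemma MemH.sqSummable_lwStep {U : ℤ → ℤ → ℝ} (hU : MemH U) (lam mu a b : ℝ) :
    SqSummable fun p : ℕ × ℕ => lwStep lam mu a b U p.1 p.2 := by
  have h1 := hU.sqSummable (s := 1) (t := 1) (by norm_num) (by norm_num)
  have h2 := hU.sqSummable (s := 1) (t := 0) (by norm_num) (by norm_num)
  have h3 := hU.sqSummable (s := 1) (t := -1) (by norm_num) (by norm_num)
  have h4 := hU.sqSummable (s := 0) (t := 1) (by norm_num) (by norm_num)
  have h5 := hU.sqSummable (s := 0) (t := 0) (by norm_num) (by norm_num)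
  have h6 := hU.sqSummable (s := 0) (t := -1) (by norm_num) (by norm_num)
  have h7 := hU.sqSummable (s := -1) (t := 1) (by norm_num) (by norm_num)
  have h8 := hU.sqSummable (s := -1) (t := 0) (by norm_num) (by norm_num)
  have h9 := hU.sqSummable (s := -1) (t := -1) (by norm_num) (by norm_num)
  simp only [add_zero, ← sub_eq_add_neg] at h1 h2 h3 h4 h5 h6 h7 h8 h9
  simp only [lwStep]
  repeat' first
    | with_reducible refine SqSummable.add ?_ ?_
    | with_reducible refine SqSummable.sub ?_ ?_
    | with_reducible refine SqSummable.const_mul _ ?_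
    | with_reducible assumption

lemma MemH.transpose {U : ℤ → ℤ → ℝ} (hU : MemH U) : MemH fun k j => U j k := by
  refine memH_of_sqSummable ?_ hU.bottom hU.left hU.corner
  have := hU.sqSummable (s := 0) (t := 0) (by norm_num) (by norm_num)
  simp only [add_zero] at this
  exact Summable.prod_symm this

lemma MemH.sqSummable_interior {U : ℤ → ℤ → ℝ} (hU : MemH U) :
    SqSummable fun p : ℕ × ℕ => U p.1 p.2 := by
  simpa only [add_zero] using hU.sqSummable (s := 0) (t := 0) (by norm_num) (by norm_num)

lemma MemH.sqSummable_left {U : ℤ → ℤ → ℝ} (hU : MemH U) : SqSummable fun k : ℕ => U 0 k :=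
  hU.sqSummable_interior.prod_factor 0

lemma MemH.sqSummable_bottom {U : ℤ → ℤ → ℝ} (hU : MemH U) : SqSummable fun j : ℕ => U j 0 :=
  hU.transpose.sqSummable_left

lemma MemH.left_corner {U : ℤ → ℤ → ℝ} (hU : MemH U) : U 0 (-1) = U 0 0 := by
  simpa using hU.bottom 0

lemma MemH.bottom_corner {U : ℤ → ℤ → ℝ} (hU : MemH U) : U (-1) 0 = U 0 0 := by
  simpa using hU.left 0

lemma MemH.left_prev {U : ℤ → ℤ → ℝ} (hU : MemH U) (k : ℕ) :
    U (-1) ((k : ℤ) - 1) = U 0 ((k : ℤ) - 1) := by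
  rcases k with _ | k
  · simp [hU.corner, hU.left_corner]
  · simpa using hU.left k

lemma MemH.left_next {U : ℤ → ℤ → ℝ} (hU : MemH U) (k : ℕ) :
    U (-1) ((k : ℤ) + 1) = U 0 ((k : ℤ) + 1) := by
  simpa using hU.left (k + 1)

/-- Columns -1 and 0 coincide, so differences across the face vanish. The squared centred difference
is rewritten by the parallelogram law with the two one-sided differences and Δ₂. -/
lemma MemH.flux1_zero {U : ℤ → ℤ → ℝ} (hU : MemH U) (α β κ : ℝ) (k : ℕ) :
    flux1 α β κ U 0 k = -α * U 0 k ^ 2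
      + α * β * (U 0 k * U 0 (k + 1) - U 0 k * U 0 (k - 1))
      - α * β ^ 2 / 4 * ((U 0 (k + 1) - U 0 k) ^ 2 + (U 0 k - U 0 (k - 1)) ^ 2)
      + (α * β ^ 2 / 4 + κ / 8) * (U 0 (k + 1) - 2 * U 0 k + U 0 (k - 1)) ^ 2 := by
  simp only [flux1, lap2, zero_sub, hU.left_prev, hU.left_next, hU.left]
  ring

lemma MemH.flux2_zero {U : ℤ → ℤ → ℝ} (hU : MemH U) (α β : ℝ) (j : ℕ) :
    flux2 α β U j 0 = -β * U j 0 ^ 2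
      - α ^ 2 * β / 4 * ((U (j + 1) 0 - U j 0) ^ 2 + (U j 0 - U (j - 1) 0) ^ 2)
      + α ^ 2 * β / 4 * (U (j + 1) 0 - 2 * U j 0 + U (j - 1) 0) ^ 2 := by
  have h1 := hU.transpose.left_prev j
  have h2 := hU.transpose.left_next j
  simp only [flux2, lap1, zero_sub, h1, h2, hU.bottom]
  ring

/-- The mixed products telescope along the side, leaving the corner term; `flux2` has no
counterpart. -/
lemma MemH.tsum_flux1_zero {U : ℤ → ℤ → ℝ} (hU : MemH U) (α β κ : ℝ) :
    ∑' k : ℕ, flux1 α β κ U 0 k = -α * ∑' k : ℕ, U 0 k ^ 2 - α * β * U 0 0 ^ 2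
      - α * β ^ 2 / 2 * ∑' k : ℕ, (U 0 (k + 1) - U 0 k) ^ 2
      + (α * β ^ 2 / 4 + κ / 8) * ∑' k : ℕ, lap2 U 0 k ^ 2 := by
  have hv := hU.sqSummable_left
  have h0 := hU.left_corner
  have h := (((hv.hasSum.mul_left (-α)).add
    ((hasSum_mul_next_sub_mul_prev hv h0).mul_left (α * β))).sub
    (((sqSummable_diff hv).hasSum.add (hasSum_diff_prev hv h0)).mul_left (α * β ^ 2 / 4))).add
    ((sqSummable_second_diff hv).hasSum.mul_left (α * β ^ 2 / 4 + κ / 8))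
  simp only [hU.flux1_zero, lap2]
  rw [h.tsum_eq]
  ring

lemma MemH.tsum_flux2_zero {U : ℤ → ℤ → ℝ} (hU : MemH U) (α β : ℝ) :
    ∑' j : ℕ, flux2 α β U j 0 = -β * ∑' j : ℕ, U j 0 ^ 2
      - α ^ 2 * β / 2 * ∑' j : ℕ, (U (j + 1) 0 - U j 0) ^ 2
      + α ^ 2 * β / 4 * ∑' j : ℕ, lap1 U j 0 ^ 2 := by
  have hv := hU.sqSummable_bottom
  have h0 := hU.bottom_corner
  have h := ((hv.hasSum.mul_left (-β)).sub
    (((sqSummable_diff (v := fun j => U j 0) hv).hasSum.add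
      (hasSum_diff_prev (v := fun j => U j 0) hv h0)).mul_left (α ^ 2 * β / 4))).add
    ((sqSummable_second_diff (v := fun j => U j 0) hv).hasSum.mul_left (α ^ 2 * β / 4))
  simp only [hU.flux2_zero, lap1]
  rw [h.tsum_eq]
  ring

/-! ### Boundary coefficients and the one-step estimate -/

/-- The coefficient condition on the left side, where the trace of the interior dissipation
is needed. -/
lemma left_coefficient_nonneg {α β κ : ℝ} (hα : α < 0) (hβ : β < 0)
    (hc : α ^ 2 + β ^ 2 ≤ 1 / 2) (hle : α ^ 2 ≤ β ^ 2)
    (hκ : κ = β ^ 2 * (α ^ 2 - β ^ 2) ^ 2 / (α ^ 2 + β ^ 2)) :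
    0 ≤ -α * (7 / 8) + -2 * α * β ^ 2
      + (4 * α * β ^ 2 + 2 * κ - β ^ 2 * (α ^ 2 + β ^ 2) / 2) := by
  have hβ2 : 0 < β ^ 2 := even_two.pow_pos hβ.ne
  have hα2 : 0 < α ^ 2 := even_two.pow_pos hα.ne
  have hc0 : 0 < α ^ 2 + β ^ 2 := by positivity
  have hκc : κ * (α ^ 2 + β ^ 2) = β ^ 2 * (α ^ 2 - β ^ 2) ^ 2 := by
    rw [hκ]; field_simp
  have hα1 : -α ≤ 1 / 2 := by nlinarith only [hc, hle, hα]
  have hα3 : 2 * α ^ 2 ≤ -α := by nlinarith only [hα1, hα]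
  -- The factor 7/8 - 2β² of -α changes sign at β² = 7/16.
  rcases le_total (β ^ 2) (7 / 16) with h | h
  · have h1 : 2 * α ^ 2 * (7 / 8 - 2 * β ^ 2) ≤ -α * (7 / 8 - 2 * β ^ 2) :=
      mul_le_mul_of_nonneg_right hα3 (by linarith)
    suffices 0 ≤ (α ^ 2 + β ^ 2) * (2 * α ^ 2 * (7 / 8 - 2 * β ^ 2) + 2 * κ
        - β ^ 2 * (α ^ 2 + β ^ 2) / 2) by
      have := nonneg_of_mul_nonneg_right this hc0
      linarith
    have h2 : (α ^ 2 + β ^ 2) * (2 * α ^ 2 * (7 / 8 - 2 * β ^ 2) + 2 * κ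
        - β ^ 2 * (α ^ 2 + β ^ 2) / 2)
        = 2 * α ^ 2 * (7 / 8 - 2 * β ^ 2) * (α ^ 2 + β ^ 2)
          + 2 * (β ^ 2 * (α ^ 2 - β ^ 2) ^ 2) - β ^ 2 * (α ^ 2 + β ^ 2) ^ 2 / 2 := by
      rw [← hκc]; ring
    rw [h2]
    generalize α ^ 2 = A at *
    generalize β ^ 2 = B at *
    -- Subtracting 7/2 times this quantity makes the polynomial homogeneous, namely the cubic of
    -- `h4`.
    have h3 : 0 ≤ A * (A + B) * (1 / 2 - (A + B)) :=
      mul_nonneg (by positivity) (by linarith)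
    have h4 : 0 ≤ 7 / 2 * A ^ 3 + 9 / 2 * A ^ 2 * B - 11 / 2 * A * B ^ 2 + 3 / 2 * B ^ 3 := by
      nlinarith only [mul_nonneg hβ2.le (sq_nonneg (5 * A - 3 * B)), mul_pos hα2 hβ2,
        mul_nonneg hα2.le (sq_nonneg (2 * A - B)), mul_nonneg hβ2.le (sq_nonneg (2 * A - B)),
        mul_nonneg hα2.le (sq_nonneg (5 * A - 2 * B)), mul_nonneg hβ2.le (sq_nonneg (5 * A - 2 * B)),
        pow_pos hα2 3, pow_pos hβ2 3]
    linarith only [h3, h4]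
  · have h1 : κ ≥ β ^ 2 * (9 / 32) := by
      rw [hκ, ge_iff_le, le_div_iff₀ hc0]
      have : (9 / 32) * (α ^ 2 + β ^ 2) ≤ (α ^ 2 - β ^ 2) ^ 2 := by
        have h2 : 3 / 8 ≤ β ^ 2 - α ^ 2 := by linarith
        nlinarith only [h2, hc]
      nlinarith only [this, hβ2]
    have h2 : -α ≤ 1 / 4 := by nlinarith only [h, hc, hα]
    have h3 : -α * (2 * β ^ 2 - 7 / 8) ≤ 1 / 4 * (2 * β ^ 2 - 7 / 8) :=
      mul_le_mul_of_nonneg_right h2 (by linarith)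
    nlinarith only [h1, h3, h, hc, hα2, hβ2]

/-- Here α² ≤ 1/4 keeps the factor of -β at least 3/8, so no interior dissipation is needed. -/
lemma bottom_coefficient_nonneg {α β : ℝ} (hβ : β < 0)
    (hc : α ^ 2 + β ^ 2 ≤ 1 / 2) (hle : α ^ 2 ≤ β ^ 2) :
    0 ≤ -β * (7 / 8) + -2 * β * α ^ 2
      + (4 * β * α ^ 2 - α ^ 2 * (α ^ 2 + β ^ 2) / 2) := by
  have h1 : α ^ 2 ≤ 1 / 4 := by linarith
  have h2 : 0 ≤ -β * (1 / 4 - α ^ 2) := mul_nonneg (by linarith) (by linarith)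
  have h3 : α ^ 2 * (α ^ 2 + β ^ 2) ≤ β ^ 2 * (1 / 2) := by
    apply mul_le_mul hle hc <;> positivity
  have h4 : -β ≤ 1 := by nlinarith only [hc, sq_nonneg α, hβ]
  nlinarith only [h2, h3, h4, hβ]

lemma energy_step_of_sq_le {α β : ℝ} (hα : α < 0) (hβ : β < 0)
    (hc : α ^ 2 + β ^ 2 ≤ 1 / 2) (hle : α ^ 2 ≤ β ^ 2) {U : ℤ → ℤ → ℝ} (hU : MemH U) :
    ∑' p : ℕ × ℕ, lwStep 1 1 α β U p.1 p.2 ^ 2 - normSqH U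
      + -α / 8 * ∑' k : ℕ, U 0 k ^ 2 + -β / 8 * ∑' j : ℕ, U j 0 ^ 2
      + β ^ 2 / 32 * (α ^ 2 + β ^ 2) * ∑' k : ℕ, lap2 U 0 k ^ 2
      + α ^ 2 / 32 * (α ^ 2 + β ^ 2) * ∑' j : ℕ, lap1 U j 0 ^ 2 ≤ 0 := by
  obtain ⟨κ, hκ⟩ : ∃ κ, κ = β ^ 2 * (α ^ 2 - β ^ 2) ^ 2 / (α ^ 2 + β ^ 2) := ⟨_, rfl⟩
  have hsum := hasSum_le (fun p : ℕ × ℕ => lwStep_energy_le hβ.ne hc U p.1 p.2 hκ)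
    ((hU.sqSummable_lwStep 1 1 α β).hasSum.sub hU.sqSummable_interior.hasSum)
    ((hasSum_telescope_fst (hU.summable_flux1 α β κ)).add
      (hasSum_telescope_snd (hU.summable_flux2 α β)))
  rw [hU.tsum_flux1_zero, hU.tsum_flux2_zero] at hsum
  -- One eighth of -α is reserved for the trace term of the conclusion. `C` collects the Δ₂ terms of
  -- the flux minus the Δ₂ trace to be controlled.
  have hL := half_line_form_lower_bound hU.sqSummable_left hU.left_corner
    (A := -α * (7 / 8)) (B := -2 * α * β ^ 2) (by linarith)
    (by nlinarith only [hα, sq_nonneg β]) (left_coefficient_nonneg hα hβ hc hle hκ)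
  have hB := half_line_form_lower_bound (v := fun j => U j 0) hU.sqSummable_bottom
    hU.bottom_corner (A := -β * (7 / 8)) (B := -2 * β * α ^ 2) (by linarith)
    (by nlinarith only [hβ, sq_nonneg α]) (bottom_coefficient_nonneg hβ hc hle)
  -- Both half-line bounds contribute A/2 at the corner; |α|, |β| ≤ 3/4 gives αβ ≤ (3/8)(|α| + |β|),
  -- below the available 7/16.
  have hcorner : α * β * U 0 0 ^ 2 ≤ (-α * (7 / 8) / 2 + -β * (7 / 8) / 2) * U 0 0 ^ 2 := by
    apply mul_le_mul_of_nonneg_right _ (sq_nonneg _)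
    have h1 : -α ≤ 3 / 4 := by nlinarith only [hα, hc, sq_nonneg β]
    have h2 : -β ≤ 3 / 4 := by nlinarith only [hβ, hc, sq_nonneg α]
    nlinarith only [mul_nonneg (neg_nonneg.2 hα.le) (sub_nonneg.2 h2),
      mul_nonneg (neg_nonneg.2 hβ.le) (sub_nonneg.2 h1)]
  simp only [normSqH, lap1, lap2] at hsum ⊢
  linarith only [hsum, hL, hB, hcorner]

/-- The energy inequality for one time step. -/
lemma energy_step {α β : ℝ} (hα : α < 0) (hβ : β < 0)
    (hc : α ^ 2 + β ^ 2 ≤ 1 / 2) {U : ℤ → ℤ → ℝ} (hU : MemH U) :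
    ∑' p : ℕ × ℕ, lwStep 1 1 α β U p.1 p.2 ^ 2 - normSqH U
      + -α / 8 * ∑' k : ℕ, U 0 k ^ 2 + -β / 8 * ∑' j : ℕ, U j 0 ^ 2
      + β ^ 2 / 32 * (α ^ 2 + β ^ 2) * ∑' k : ℕ, lap2 U 0 k ^ 2
      + α ^ 2 / 32 * (α ^ 2 + β ^ 2) * ∑' j : ℕ, lap1 U j 0 ^ 2 ≤ 0 := by
  rcases le_total (α ^ 2) (β ^ 2) with hle | hle
  · exact energy_step_of_sq_le hα hβ hc hle hU
  · have h := energy_step_of_sq_le hβ hα (by linarith) hle hU.transpose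
    have h1 : ∑' p : ℕ × ℕ, lwStep 1 1 β α (fun k j => U j k) p.1 p.2 ^ 2
        = ∑' p : ℕ × ℕ, lwStep 1 1 α β U p.1 p.2 ^ 2 := by
      rw [← (Equiv.prodComm ℕ ℕ).tsum_eq]
      exact tsum_congr fun p => by rw [← lwStep_transpose]; rfl
    have h2 : normSqH (fun k j => U j k) = normSqH U := by
      rw [normSqH, ← (Equiv.prodComm ℕ ℕ).tsum_eq]
      rfl
    rw [h1, h2] at h
    simp only [lap1, lap2] at h ⊢
    linarith only [h]

/-! ### Summation over time steps -/

lemma IsNumericalSolution.memH {lam mu a b : ℝ} {u : ℕ → ℤ → ℤ → ℝ}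
    (hu : IsNumericalSolution lam mu a b u) (n : ℕ) : MemH (u n) := by
  induction n with
  | zero => exact hu.init
  | succ n ih =>
    refine memH_of_sqSummable ?_ (hu.left _) (hu.bottom _) (hu.corner _)
    exact (ih.sqSummable_lwStep lam mu a b).congr fun p => congrArg (· ^ 2) (hu.scheme n p.1 p.2).symm

/-- A nonnegative sequence whose decrements dominate a nonnegative sequence. -/
lemma summable_and_tsum_le_of_decrement {E T : ℕ → ℝ} (hE : ∀ n, 0 ≤ E n) (hT : ∀ n, 0 ≤ T n)
    (h : ∀ n, E (n + 1) + T n ≤ E n) : Summable T ∧ ∑' n, T n ≤ E 0 := by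
  have hpart : ∀ N, ∑ n ∈ Finset.range N, T n ≤ E 0 - E N := by
    intro N
    induction N with
    | zero => simp
    | succ N ih => rw [Finset.sum_range_succ]; linarith [h N]
  have hle : ∀ N, ∑ n ∈ Finset.range N, T n ≤ E 0 := fun N => by linarith [hpart N, hE N]
  exact ⟨summable_of_sum_range_le hT hle, Real.tsum_le_of_sum_range_le hT hle⟩

lemma summable_of_const_mul_le {S T : ℕ → ℝ} {c : ℝ} (hc : 0 < c) (hS : ∀ n, 0 ≤ S n)
    (h : ∀ n, c * S n ≤ T n) (hT : Summable T) : Summable S :=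
  (summable_mul_left_iff hc.ne').1
    (hT.of_nonneg_of_le (fun n => mul_nonneg hc.le (hS n)) h)

/-- Summing the energy inequality over all time steps. -/
lemma global_estimate_of_decrement {E S₁ S₂ S₃ S₄ : ℕ → ℝ} {c₁ c₂ c₃ c₄ : ℝ}
    (hE : ∀ n, 0 ≤ E n) (h₁ : ∀ n, 0 ≤ S₁ n) (h₂ : ∀ n, 0 ≤ S₂ n) (h₃ : ∀ n, 0 ≤ S₃ n)
    (h₄ : ∀ n, 0 ≤ S₄ n) (hc₁ : 0 < c₁) (hc₂ : 0 < c₂) (hc₃ : 0 < c₃) (hc₄ : 0 < c₄)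
    (h : ∀ n, E (n + 1) - E n + c₁ * S₁ n + c₂ * S₂ n + c₃ * S₃ n + c₄ * S₄ n ≤ 0) :
    BddAbove (Set.range E) ∧ Summable S₁ ∧ Summable S₂ ∧ Summable S₃ ∧ Summable S₄ ∧
      (⨆ n, E n) + c₁ * ∑' n, S₁ n + c₂ * ∑' n, S₂ n + c₃ * ∑' n, S₃ n + c₄ * ∑' n, S₄ n
        ≤ 2 * E 0 := by
  have p₁ := fun n => mul_nonneg hc₁.le (h₁ n)
  have p₂ := fun n => mul_nonneg hc₂.le (h₂ n)
  have p₃ := fun n => mul_nonneg hc₃.le (h₃ n)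
  have p₄ := fun n => mul_nonneg hc₄.le (h₄ n)
  have hanti : Antitone E := antitone_nat_of_succ_le fun n => by
    linarith [h n, p₁ n, p₂ n, p₃ n, p₄ n]
  have hle : ∀ n, E n ≤ E 0 := fun n => hanti n.zero_le
  obtain ⟨hT, hTle⟩ := summable_and_tsum_le_of_decrement
    (T := fun n => c₁ * S₁ n + c₂ * S₂ n + c₃ * S₃ n + c₄ * S₄ n) hE
    (fun n => by linarith [p₁ n, p₂ n, p₃ n, p₄ n]) (fun n => by linarith [h n])
  have s₁ : Summable S₁ := summable_of_const_mul_le hc₁ h₁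
    (fun n => by linarith [p₂ n, p₃ n, p₄ n]) hT
  have s₂ : Summable S₂ := summable_of_const_mul_le hc₂ h₂
    (fun n => by linarith [p₁ n, p₃ n, p₄ n]) hT
  have s₃ : Summable S₃ := summable_of_const_mul_le hc₃ h₃
    (fun n => by linarith [p₁ n, p₂ n, p₄ n]) hT
  have s₄ : Summable S₄ := summable_of_const_mul_le hc₄ h₄
    (fun n => by linarith [p₁ n, p₂ n, p₃ n]) hT
  have hsum := (((s₁.hasSum.mul_left c₁).add (s₂.hasSum.mul_left c₂)).add
    (s₃.hasSum.mul_left c₃)).add (s₄.hasSum.mul_left c₄)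
  rw [hsum.tsum_eq] at hTle
  -- The factor 2 arises because the supremum and the total of the trace terms are each at most `E
  -- 0`.
  exact ⟨⟨E 0, by rintro _ ⟨n, rfl⟩; exact hle n⟩, s₁, s₂, s₃, s₄,
    by linarith [ciSup_le hle]⟩

end LaxWendroff

theorem theorem2 (a b lam mu : ℝ) (ha : a < 0) (hb : b < 0) (hlam : 0 < lam) (hmu : 0 < mu)
    (hCFL : (lam * a) ^ 2 + (mu * b) ^ 2 ≤ 1 / 2)
    (u : ℕ → ℤ → ℤ → ℝ) (hu : LaxWendroff.IsNumericalSolution lam mu a b u) :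
    -- the numerical solution stays in the space, and all the trace sums converge
    (∀ n : ℕ, LaxWendroff.MemH (u n)
      ∧ Summable (fun p : ℕ × ℕ => (u n p.1 p.2) ^ 2)
      ∧ Summable (fun k : ℕ => (u n 0 k) ^ 2)
      ∧ Summable (fun j : ℕ => (u n j 0) ^ 2)
      ∧ Summable (fun k : ℕ => (LaxWendroff.lap2 (u n) 0 k) ^ 2)
      ∧ Summable (fun j : ℕ => (LaxWendroff.lap1 (u n) j 0) ^ 2)) ∧
    -- the energy inequality at each time step
    (∀ n : ℕ,
      LaxWendroff.normSqH (u (n + 1)) - LaxWendroff.normSqH (u n)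
        + lam * |a| / 8 * ∑' k : ℕ, (u n 0 k) ^ 2
        + mu * |b| / 8 * ∑' j : ℕ, (u n j 0) ^ 2
        + (mu * b) ^ 2 / 32 * ((lam * a) ^ 2 + (mu * b) ^ 2)
            * ∑' k : ℕ, (LaxWendroff.lap2 (u n) 0 k) ^ 2
        + (lam * a) ^ 2 / 32 * ((lam * a) ^ 2 + (mu * b) ^ 2)
            * ∑' j : ℕ, (LaxWendroff.lap1 (u n) j 0) ^ 2 ≤ 0) ∧
    -- the sums over all time steps converge, and the global stability and trace estimate holds
    BddAbove (Set.range fun n : ℕ => LaxWendroff.normSqH (u n)) ∧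
    Summable (fun n : ℕ => ∑' k : ℕ, (u n 0 k) ^ 2) ∧
    Summable (fun n : ℕ => ∑' j : ℕ, (u n j 0) ^ 2) ∧
    Summable (fun n : ℕ => ∑' k : ℕ, (LaxWendroff.lap2 (u n) 0 k) ^ 2) ∧
    Summable (fun n : ℕ => ∑' j : ℕ, (LaxWendroff.lap1 (u n) j 0) ^ 2) ∧
    (⨆ n : ℕ, LaxWendroff.normSqH (u n))
        + lam * |a| / 8 * ∑' n : ℕ, ∑' k : ℕ, (u n 0 k) ^ 2
        + mu * |b| / 8 * ∑' n : ℕ, ∑' j : ℕ, (u n j 0) ^ 2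
        + (mu * b) ^ 2 / 32 * ((lam * a) ^ 2 + (mu * b) ^ 2)
            * ∑' n : ℕ, ∑' k : ℕ, (LaxWendroff.lap2 (u n) 0 k) ^ 2
        + (lam * a) ^ 2 / 32 * ((lam * a) ^ 2 + (mu * b) ^ 2)
            * ∑' n : ℕ, ∑' j : ℕ, (LaxWendroff.lap1 (u n) j 0) ^ 2
      ≤ 2 * LaxWendroff.normSqH (u 0) := by
  have hα : lam * a < 0 := mul_neg_of_pos_of_neg hlam ha
  have hβ : mu * b < 0 := mul_neg_of_pos_of_neg hmu hb
  have hmem := hu.memH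
  have hstep : ∀ n : ℕ,
      LaxWendroff.normSqH (u (n + 1)) - LaxWendroff.normSqH (u n)
        + lam * |a| / 8 * ∑' k : ℕ, (u n 0 k) ^ 2
        + mu * |b| / 8 * ∑' j : ℕ, (u n j 0) ^ 2
        + (mu * b) ^ 2 / 32 * ((lam * a) ^ 2 + (mu * b) ^ 2)
            * ∑' k : ℕ, (LaxWendroff.lap2 (u n) 0 k) ^ 2
        + (lam * a) ^ 2 / 32 * ((lam * a) ^ 2 + (mu * b) ^ 2)
            * ∑' j : ℕ, (LaxWendroff.lap1 (u n) j 0) ^ 2 ≤ 0 := fun n => by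
    have h := LaxWendroff.energy_step hα hβ hCFL (hmem n)
    have hn : LaxWendroff.normSqH (u (n + 1)) = ∑' p : ℕ × ℕ,
        LaxWendroff.lwStep 1 1 (lam * a) (mu * b) (u n) p.1 p.2 ^ 2 :=
      tsum_congr fun p => by rw [hu.scheme, LaxWendroff.lwStep_eq_lwStep_one]
    rw [hn, abs_of_neg ha, abs_of_neg hb, mul_neg, mul_neg]
    exact h
  have hla : 0 < lam * |a| / 8 := by have := abs_pos.2 ha.ne; positivity
  have hmb : 0 < mu * |b| / 8 := by have := abs_pos.2 hb.ne; positivity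
  have hα2 : 0 < (lam * a) ^ 2 := even_two.pow_pos hα.ne
  have hβ2 : 0 < (mu * b) ^ 2 := even_two.pow_pos hβ.ne
  have hc3 : 0 < (mu * b) ^ 2 / 32 * ((lam * a) ^ 2 + (mu * b) ^ 2) := by positivity
  have hc4 : 0 < (lam * a) ^ 2 / 32 * ((lam * a) ^ 2 + (mu * b) ^ 2) := by positivity
  refine ⟨fun n => ⟨hmem n, (hmem n).sqSummable_interior, (hmem n).sqSummable_left,
    (hmem n).sqSummable_bottom,
    LaxWendroff.sqSummable_second_diff (hmem n).sqSummable_left,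
    LaxWendroff.sqSummable_second_diff (v := fun j => u n j 0) (hmem n).sqSummable_bottom⟩, hstep, ?_⟩
  have hE : ∀ n, 0 ≤ LaxWendroff.normSqH (u n) := fun n => tsum_nonneg fun _ => sq_nonneg _
  have hS1 : ∀ n, 0 ≤ ∑' k : ℕ, (u n 0 k) ^ 2 := fun n => tsum_nonneg fun _ => sq_nonneg _
  have hS2 : ∀ n, 0 ≤ ∑' j : ℕ, (u n j 0) ^ 2 := fun n => tsum_nonneg fun _ => sq_nonneg _
  have hS3 : ∀ n, 0 ≤ ∑' k : ℕ, (LaxWendroff.lap2 (u n) 0 k) ^ 2 :=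
    fun n => tsum_nonneg fun _ => sq_nonneg _
  have hS4 : ∀ n, 0 ≤ ∑' j : ℕ, (LaxWendroff.lap1 (u n) j 0) ^ 2 :=
    fun n => tsum_nonneg fun _ => sq_nonneg _
  exact LaxWendroff.global_estimate_of_decrement hE hS1 hS2 hS3 hS4 hla hmb hc3 hc4 hstep
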